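/- Let $\mathbf L=\langle\lor,\land,\to,{}',0,1\rangle$ (on formulas $'$, $0$, $1$ are written $\sim$, $\bot$, $\top$), and let $Fm$ be the set of $\mathbf L$-formulas over a denumerable set of variables. Abbreviate $x\to_H y:=x\to(x\land y)$, $x\leftrightarrow_H y:=(x\to_H y)\land(y\to_H x)$, and $x^*:=x\to 0$, also written $\neg x$. **The class $\mathbb{RUNO}1$.** An $\mathbf L$-algebra is in $\mathbb{RUNO}1$ iff $\langle\lor,\land,0,1\rangle$ is a lattice with least element $0$ and greatest element $1$ and it satisfies $x\land(x\to y)\approx x\land y$; $\;x\land(y\to z)\approx x\land[(x\land y)\to(x\land z)]$; $\;x\to x\approx1$ (semi-Heyting); $0'\approx1$; $\;1'\approx0$; $\;(x\land y)'\approx x'\lor y'$; $\;(x\lor y)''\approx x''\lor y''$; $\;x''\le x$; $\;x''\approx x$ (De Morgan); $(0\to1)'\approx0\to1$ (unorthodox); $\;x\land x'{}^{*}{}'\le y\lor y^*$ (regular); $\;x\land x'{}^*\approx(x\land x'{}^*)'{}^*$ (level 1). **The logic $\mathcal{RUNO}1$.** It is given by the following axioms and rules. $\Gamma\vdash\varphi$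 means that there is a finite sequence of formulas ending in $\varphi$, each of which is in $\Gamma$, or is a substitution instance of an axiom, or follows from earlier ones by a substitution instance of a rule. * Axioms of semi-Heyting logic: $\alpha\to_H(\alpha\lor\beta)$; $\;\beta\to_H(\alpha\lor\beta)$; $\;(\alpha\to_H\gamma)\to_H[(\beta\to_H\gamma)\to_H((\alpha\lor\beta)\to_H\gamma)]$; $\;(\alpha\land\beta)\to_H\alpha$; $\;(\gamma\to_H\alpha)\to_H[(\gamma\to_H\beta)\to_H(\gamma\to_H(\alpha\land\beta))]$; $\;\top$; $\;\bot\to_H\alpha$; $\;[(\alpha\land\beta)\to_H\gamma]\to_H[\alpha\to_H(\beta\to_H\gamma)]$; $\;[\alpha\to_H(\beta\to_H\gamma)]\to_H[(\alpha\land\beta)\to_H\gamma]$; $\;(\alpha\to_H\beta)\to_H[(\beta\to_H\alpha)\to_H((\alpha\to\gamma)\to_H(\beta\to\gamma))]$; $\;(\alpha\to_H\beta)\to_H[(\beta\to_H\alpha)\to_H((\gamma\to\beta)\to_H(\gamma\to\alpha))]$. * De Morgan axioms: $\top\leftrightarrow_H{\sim}\bot$; $\;{\sim}(\alpha\land\beta)\leftrightarrow_H({\sim}\alpha\lor{\sim}\beta)$;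 $\;{\sim}(\alpha\lor\beta)\leftrightarrow_H({\sim}\alpha\land{\sim}\beta)$; $\;{\sim}{\sim}\alpha\leftrightarrow_H\alpha$. * Rules: from $\varphi$ and $\varphi\to_H\gamma$ infer $\gamma$; from $\varphi\to_H\gamma$ infer ${\sim}\gamma\to_H{\sim}\varphi$. (So far this is the logic $\mathcal{DMSH}$.) * Additional axioms: ${\sim}(\bot\to\top)\leftrightarrow_H(\bot\to\top)$ (unorthodoxy); $\;(\alpha\land{\sim}\neg{\sim}\alpha)\lor(\beta\lor\neg\beta)\leftrightarrow_H(\beta\lor\neg\beta)$ (regularity); $\;\neg{\sim}(\alpha\land\neg{\sim}\alpha)\leftrightarrow_H\alpha\land\neg{\sim}\alpha$ (level 1). **Algebraizability.** A logic is a finitary, structural (substitution-invariant) consequence relation $\vdash$ on $Fm$. For a class $\mathbb K$ of $\mathbf L$-algebras, a set $\Sigma$ of identities and an identity $e$, write $\Sigma\models_{\mathbb K}e$ if in every $\mathbf A\in\mathbb K$ every interpretation of the variables that makes all members of $\Sigma$ true makes $e$ true; for a set $T$ of identities, $\Sigma\models_{\mathbb K}T$ means $\Sigma\models_{\mathbb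 K}e$ for all $e\in T$. $\mathbb K$ is an equivalent algebraic semantics of $\vdash$, witnessed by a finite set $E(x)$ of identities in one variable and a finite set $\Delta(x,y)$ of formulas in two variables, if for all $\Gamma\cup\{\varphi,\psi\}\subseteq Fm$: 1. $\Gamma\vdash\varphi$ if and only if $\bigcup_{\gamma\in\Gamma}E(\gamma)\models_{\mathbb K}E(\varphi)$; 2. $\{\varphi\approx\psi\}\models_{\mathbb K}\bigcup_{\delta\in\Delta}E(\delta(\varphi,\psi))$ and $\bigcup_{\delta\in\Delta}E(\delta(\varphi,\psi))\models_{\mathbb K}\varphi\approx\psi$. A logic is algebraizable (in the sense of Blok and Pigozzi) if it has an equivalent algebraic semantics. **Corollary 8.3.** The logic $\mathcal{RUNO}1$ is algebraizable. The class $\mathbb{RUNO}1$ is a variety (it is defined by a set of identities), and it is an equivalent algebraic semantics of $\mathcal{RUNO}1$, witnessed by $E(x)$ and $\Delta(x,y)$, where for $E(x)$ one may take either of $\{x\approx x\to_H x\}$ and $\{x\approx1\}$, and for $\Delta(x,y)$ either of $\{x\to_H y,\;y\to_H x\}$ and $\{x\leftrightarrow_H y\}$, in any combination. -/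

import Mathlib

universe u

namespace UnorthodoxLogic

/-! ### Algebras and formulas of type ⟨∨, ∧, →, ', 0, 1⟩ -/

/-- An algebra of type ⟨∨, ∧, →, ', 0, 1⟩: no laws are assumed. The operations are written
`⊔`, `⊓`, `⇨`, `dm`, `⊥`, `⊤`. -/
class LAlgebra (A : Type u) extends Max A, Min A, HImp A, Bot A, Top A where
  /-- the unary operation `'` (written `∼` on formulas) -/
  dm : A → A

open LAlgebra

/-- `x* := x → 0` (written `¬` on formulas). -/
def pseudo {A : Type u} [LAlgebra A] (x : A) : A := x ⇨ ⊥

/-- `x →_H y := x → (x ∧ y)`. -/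
def impH {A : Type u} [LAlgebra A] (x y : A) : A := x ⇨ (x ⊓ y)

infixr:60 " →ₕ " => impH

/-- `x ↔_H y := (x →_H y) ∧ (y →_H x)`. -/
def iffH {A : Type u} [LAlgebra A] (x y : A) : A := (x →ₕ y) ⊓ (y →ₕ x)

infix:55 " ↔ₕ " => iffH

/-- Formulas (terms) over a set `V` of variables. -/
inductive Formula (V : Type) : Type
  | var : V → Formula V
  | or : Formula V → Formula V → Formula V
  | and : Formula V → Formula V → Formula V
  | imp : Formula V → Formula V → Formula V
  | neg : Formula V → Formula V
  | bot : Formula V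
  | top : Formula V

/-- The algebra of formulas. -/
instance instLAlgebraFormula (V : Type) : LAlgebra (Formula V) where
  max := Formula.or
  min := Formula.and
  himp := Formula.imp
  bot := Formula.bot
  top := Formula.top
  dm := Formula.neg

/-- The homomorphism from the algebra of formulas into `A` that extends `v : V → A`. -/
def Formula.eval {V : Type} {A : Type u} [LAlgebra A] (v : V → A) : Formula V → A
  | .var x => v x
  | .or φ ψ => φ.eval v ⊔ ψ.eval v
  | .and φ ψ => φ.eval v ⊓ ψ.eval v
  | .imp φ ψ => φ.eval v ⇨ ψ.eval v
  | .neg φ => dm (φ.eval v)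
  | .bot => ⊥
  | .top => ⊤

/-- Simultaneous substitution: the homomorphism between formula algebras that extends `σ`. -/
def Formula.subst {V W : Type} (σ : V → Formula W) (φ : Formula V) : Formula W := φ.eval σ

/-- The formulas of the logics, over a denumerable set of variables. -/
abbrev Fm : Type := Formula ℕ

/-- An identity `lhs ≈ rhs`. -/
structure Identity (V : Type) : Type where
  lhs : Formula V
  rhs : Formula V

infix:50 " ≈ₗ " => Identity.mk

/-- The identity `e` is true in `A` under the interpretation `v` of the variables. -/
def Identity.HoldsAt {V : Type} {A : Type u} [LAlgebra A] (e : Identity V) (v : V → A) : Prop :=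
  e.lhs.eval v = e.rhs.eval v

/-- `A ⊨ e`. -/
def Identity.ValidIn {V : Type} (e : Identity V) (A : Type u) [LAlgebra A] : Prop :=
  ∀ v : V → A, e.HoldsAt v

def Identity.subst {V W : Type} (σ : V → Formula W) (e : Identity V) : Identity W :=
  e.lhs.subst σ ≈ₗ e.rhs.subst σ

/-! ### Classes of algebras -/

/-- A class of algebras of the given type. -/
abbrev AlgClass : Type (u + 1) := ∀ (A : Type u) [LAlgebra A], Prop

/-- A variety: a class of algebras that is defined by a set of identities. -/
def IsVariety (K : AlgClass.{u}) : Prop :=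
  ∃ S : Set (Identity ℕ), ∀ (A : Type u) [LAlgebra A], K A ↔ ∀ e ∈ S, e.ValidIn A

/-- The relation `G ⊨_K e`. -/
def EqConsequence (K : AlgClass.{u}) (G : Set (Identity ℕ)) (e : Identity ℕ) : Prop :=
  ∀ (A : Type u) [LAlgebra A], K A →
    ∀ v : ℕ → A, (∀ s ∈ G, s.HoldsAt v) → e.HoldsAt v

/-- Semi-Heyting algebras. -/
structure IsSemiHeyting (A : Type u) [LAlgebra A] : Prop where
  inf_comm : ∀ x y : A, x ⊓ y = y ⊓ x
  sup_comm : ∀ x y : A, x ⊔ y = y ⊔ x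
  inf_assoc : ∀ x y z : A, (x ⊓ y) ⊓ z = x ⊓ (y ⊓ z)
  sup_assoc : ∀ x y z : A, (x ⊔ y) ⊔ z = x ⊔ (y ⊔ z)
  inf_sup_self : ∀ x y : A, x ⊓ (x ⊔ y) = x
  sup_inf_self : ∀ x y : A, x ⊔ (x ⊓ y) = x
  bot_inf : ∀ x : A, ⊥ ⊓ x = ⊥
  inf_top : ∀ x : A, x ⊓ ⊤ = x
  inf_imp : ∀ x y : A, x ⊓ (x ⇨ y) = x ⊓ y
  inf_imp_inf : ∀ x y z : A, x ⊓ (y ⇨ z) = x ⊓ ((x ⊓ y) ⇨ (x ⊓ z))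
  imp_self : ∀ x : A, x ⇨ x = ⊤

/-- Dually hemimorphic semi-Heyting algebras. -/
structure IsDHMSH (A : Type u) [LAlgebra A] : Prop extends IsSemiHeyting A where
  dm_bot : dm (⊥ : A) = ⊤
  dm_top : dm (⊤ : A) = ⊥
  dm_inf : ∀ x y : A, dm (x ⊓ y) = dm x ⊔ dm y

/-- Dually quasi-De Morgan semi-Heyting algebras. -/
structure IsDQDSH (A : Type u) [LAlgebra A] : Prop extends IsDHMSH A where
  dm_dm_sup : ∀ x y : A, dm (dm (x ⊔ y)) = dm (dm x) ⊔ dm (dm y)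
  /-- `x'' ≤ x` -/
  dm_dm_le : ∀ x : A, dm (dm x) ⊓ x = dm (dm x)

/-- De Morgan semi-Heyting algebras. -/
structure IsDMSH (A : Type u) [LAlgebra A] : Prop extends IsDQDSH A where
  dm_dm : ∀ x : A, dm (dm x) = x

/-- Unorthodox De Morgan semi-Heyting algebras. -/
structure IsUNO (A : Type u) [LAlgebra A] : Prop extends IsDMSH A where
  unorthodox : dm ((⊥ : A) ⇨ ⊤) = ⊥ ⇨ ⊤

/-- Regular unorthodox De Morgan semi-Heyting algebras. -/
structure IsRUNO (A : Type u) [LAlgebra A] : Prop extends IsUNO A where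
  /-- `x ∧ x'*' ≤ y ∨ y*` -/
  regular : ∀ x y : A,
    (x ⊓ dm (pseudo (dm x))) ⊓ (y ⊔ pseudo y) = x ⊓ dm (pseudo (dm x))

/-- Regular unorthodox De Morgan semi-Heyting algebras of level 1. -/
structure IsRUNO1 (A : Type u) [LAlgebra A] : Prop extends IsRUNO A where
  level_one : ∀ x : A, x ⊓ pseudo (dm x) = pseudo (dm (x ⊓ pseudo (dm x)))

/-- The class of regular unorthodox De Morgan semi-Heyting algebras of level 1. -/
def RUNO1Class : AlgClass.{u} := fun A _ => IsRUNO1 A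

/-! ### Logics -/

/-- A logic: a finitary structural consequence relation on formulas. -/
structure IsLogic (C : Set Fm → Fm → Prop) : Prop where
  refl : ∀ (G : Set Fm) (φ : Fm), φ ∈ G → C G φ
  mono : ∀ (G D : Set Fm) (φ : Fm), C G φ → G ⊆ D → C D φ
  cut : ∀ (G D : Set Fm) (φ : Fm), C G φ → (∀ β ∈ G, C D β) → C D φ
  finitary : ∀ (G : Set Fm) (φ : Fm), C G φ → ∃ G' ⊆ G, G'.Finite ∧ C G' φ
  structural : ∀ (σ : ℕ → Fm) (G : Set Fm) (φ : Fm),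
    C G φ → C (Formula.subst σ '' G) (φ.subst σ)

/-- A Hilbert-style presentation: axioms, and rules `⟨premises, conclusion⟩`. -/
structure HilbertSystem : Type where
  axs : Set Fm
  rules : Set (Set Fm × Fm)

/-- The list `l` is a formal proof from `G`. -/
def HilbertSystem.IsProof (H : HilbertSystem) (G : Set Fm) (l : List Fm) : Prop :=
  ∀ (i : ℕ) (hi : i < l.length),
    l[i] ∈ G ∨
    (∃ ψ ∈ H.axs, ∃ σ : ℕ → Fm, l[i] = ψ.subst σ) ∨
    (∃ r ∈ H.rules, ∃ σ : ℕ → Fm, l[i] = r.2.subst σ ∧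
      ∀ δ ∈ r.1, ∃ (j : ℕ) (hj : j < i), l[j] = δ.subst σ)

/-- `G ⊢ φ`: there is a formal proof from `G` whose last formula is `φ`. -/
def HilbertSystem.Proves (H : HilbertSystem) (G : Set Fm) (φ : Fm) : Prop :=
  ∃ l : List Fm, H.IsProof G l ∧ l.getLast? = some φ

/-- The axiomatic extension of `H` by the axioms in `S`; the rules stay the same. -/
def HilbertSystem.axiomaticExtension (H : HilbertSystem) (S : Set Fm) : HilbertSystem where
  axs := H.axs ∪ S
  rules := H.rules

/-- The axioms of semi-Heyting logic. -/
def semiHeytingAxs : Set Fm :=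
  let α : Fm := .var 0
  let β : Fm := .var 1
  let γ : Fm := .var 2
  { α →ₕ (α ⊔ β),
    β →ₕ (α ⊔ β),
    (α →ₕ γ) →ₕ ((β →ₕ γ) →ₕ ((α ⊔ β) →ₕ γ)),
    (α ⊓ β) →ₕ α,
    (γ →ₕ α) →ₕ ((γ →ₕ β) →ₕ (γ →ₕ (α ⊓ β))),
    ⊤,
    ⊥ →ₕ α,
    ((α ⊓ β) →ₕ γ) →ₕ (α →ₕ (β →ₕ γ)),
    (α →ₕ (β →ₕ γ)) →ₕ ((α ⊓ β) →ₕ γ),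
    (α →ₕ β) →ₕ ((β →ₕ α) →ₕ ((α ⇨ γ) →ₕ (β ⇨ γ))),
    (α →ₕ β) →ₕ ((β →ₕ α) →ₕ ((γ ⇨ β) →ₕ (γ ⇨ α))) }

/-- The De Morgan axioms. -/
def deMorganAxs : Set Fm :=
  let α : Fm := .var 0
  let β : Fm := .var 1
  { ⊤ ↔ₕ dm ⊥,
    dm (α ⊓ β) ↔ₕ (dm α ⊔ dm β),
    dm (α ⊔ β) ↔ₕ (dm α ⊓ dm β),
    dm (dm α) ↔ₕ α }

/-- The rules (SMP) and (SCP). -/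
def dmshRules : Set (Set Fm × Fm) :=
  let φ : Fm := .var 0
  let γ : Fm := .var 1
  { ({φ, φ →ₕ γ}, γ),
    ({φ →ₕ γ}, dm γ →ₕ dm φ) }

/-- De Morgan semi-Heyting logic. -/
def dmshLogic : HilbertSystem where
  axs := semiHeytingAxs ∪ deMorganAxs
  rules := dmshRules

/-- The axioms of unorthodoxy, regularity and level 1. -/
def runo1Axs : Set Fm :=
  let α : Fm := .var 0
  let β : Fm := .var 1
  { dm (⊥ ⇨ ⊤) ↔ₕ (⊥ ⇨ ⊤),
    ((α ⊓ dm (pseudo (dm α))) ⊔ (β ⊔ pseudo β)) ↔ₕ (β ⊔ pseudo β),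
    pseudo (dm (α ⊓ pseudo (dm α))) ↔ₕ (α ⊓ pseudo (dm α)) }

/-- The logic of regular unorthodox algebras of level 1. -/
def runo1Logic : HilbertSystem := dmshLogic.axiomaticExtension runo1Axs

/-! ### Algebraizability -/

/-- The set `{δ[ψ/p] ≈ ε[ψ/p] : δ ≈ ε ∈ E}`. -/
def instE (E : Set (Identity (Fin 1))) (ψ : Fm) : Set (Identity ℕ) :=
  Identity.subst (fun _ => ψ) '' E

/-- `K` is an algebraic semantics for `C` with defining identities `E` (in a single variable). -/
structure IsAlgebraicSemantics (C : Set Fm → Fm → Prop) (K : AlgClass.{u})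
    (E : Set (Identity (Fin 1))) : Prop where
  finite_E : E.Finite
  iff_consequence : ∀ (G : Set Fm) (φ : Fm),
    C G φ ↔ ∀ e ∈ instE E φ, EqConsequence K (⋃ ψ ∈ G, instE E ψ) e

/-- The set `{δ(Δ(φ,ψ)) ≈ ε(Δ(φ,ψ)) : δ ≈ ε ∈ E, Δ ∈ D}`. -/
def instED (E : Set (Identity (Fin 1))) (D : Set (Formula (Fin 2))) (φ ψ : Fm) :
    Set (Identity ℕ) :=
  ⋃ d ∈ D, instE E (d.subst ![φ, ψ])

/-- `K` is an equivalent algebraic semantics for `C` with defining identities `E` (in a single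
variable) and equivalence system `D` (in two variables). -/
structure IsEquivalentAlgebraicSemantics (C : Set Fm → Fm → Prop) (K : AlgClass.{u})
    (E : Set (Identity (Fin 1))) (D : Set (Formula (Fin 2))) : Prop
    extends IsAlgebraicSemantics C K E where
  finite_D : D.Finite
  identity_to_D : ∀ φ ψ : Fm, ∀ e ∈ instED E D φ ψ, EqConsequence K {φ ≈ₗ ψ} e
  D_to_identity : ∀ φ ψ : Fm, EqConsequence K (instED E D φ ψ) (φ ≈ₗ ψ)

/-- `C` is a logic that is algebraizable in the sense of Blok and Pigozzi. -/
def IsAlgebraizable (C : Set Fm → Fm → Prop) : Prop :=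
  IsLogic C ∧ ∃ (K : AlgClass.{u}) (E : Set (Identity (Fin 1))) (D : Set (Formula (Fin 2))),
    IsEquivalentAlgebraicSemantics C K E D

end UnorthodoxLogic

open UnorthodoxLogic

namespace UnorthodoxLogic

open LAlgebra

/-! ### Substitution -/

/-! The core is a strong completeness theorem, `RUNO1.proves_iff_forall_eval_eq_top`: a formula is
provable from `G` exactly when, in the algebras of the class, every interpretation sending `G` to
`⊤` sends it to `⊤`.

Soundness rests on one fact: in a semi-Heyting algebra `→ₕ` is the residual of the meet
(`IsSemiHeyting.inf_impH_eq_left_iff`). Hence `x →ₕ y = ⊤` means `x ≤ y`, and `x ↔ₕ y = ⊤` means `x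
= y`. The same fact shows that each choice of `E` expresses truth and each choice of `D` expresses
equality, so algebraizability follows from completeness.

For completeness, formulas are divided by provable equivalence from `G`; the class of a formula is
`⊤` exactly when the formula is derivable. The work is to place this quotient in the class. No axiom
states transitivity of `→ₕ`. But `a →ₕ b` is literally `a ⇨ (a ⊓ b)`, and consequents of `⇨` may be
replaced by equivalent ones; this yields reflexivity and then transitivity (`RUNO1.le_trans`).
Congruence of `⇨` relative to an assumption (`RUNO1.le_imp_congr`) then gives the semi-Heyting laws.
-/

theorem Formula.eval_subst {V W : Type} {A : Type u} [LAlgebra A] (σ : V → Formula W)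
    (v : W → A) (φ : Formula V) : (φ.subst σ).eval v = φ.eval fun x => (σ x).eval v := by
  induction φ with
  | var x => rfl
  | or a b iha ihb => exact congrArg₂ (· ⊔ ·) iha ihb
  | and a b iha ihb => exact congrArg₂ (· ⊓ ·) iha ihb
  | imp a b iha ihb => exact congrArg₂ (· ⇨ ·) iha ihb
  | neg a ih => exact congrArg dm ih
  | bot => rfl
  | top => rfl

/-! ### Derivability in a Hilbert system -/

/-- Derivability from `G`, as an inductive predicate. -/
inductive HilbertSystem.Derives (H : HilbertSystem) (G : Set Fm) : Fm → Prop
  | hyp {φ : Fm} : φ ∈ G → H.Derives G φ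
  | ax {ψ : Fm} (hψ : ψ ∈ H.axs) (σ : ℕ → Fm) : H.Derives G (ψ.subst σ)
  | rule {r : Set Fm × Fm} (hr : r ∈ H.rules) (σ : ℕ → Fm) :
      (∀ δ ∈ r.1, H.Derives G (δ.subst σ)) → H.Derives G (r.2.subst σ)

namespace HilbertSystem

variable {H : HilbertSystem} {G : Set Fm} {l₁ l₂ : List Fm}

theorem IsProof.derives {l : List Fm} (h : H.IsProof G l) :
    ∀ (i : ℕ) (hi : i < l.length), H.Derives G l[i] := by
  intro i
  induction i using Nat.strong_induction_on with
  | _ i ih =>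
    intro hi
    rcases h i hi with hG | ⟨ψ, hψ, σ, e⟩ | ⟨r, hr, σ, e, hp⟩
    · exact .hyp hG
    · exact e ▸ .ax hψ σ
    · rw [e]
      refine .rule hr σ fun δ hδ => ?_
      obtain ⟨j, hj, e'⟩ := hp δ hδ
      exact e' ▸ ih j hj (hj.trans hi)

theorem Proves.derives {φ : Fm} (h : H.Proves G φ) : H.Derives G φ := by
  obtain ⟨l, hl, hlast⟩ := h
  obtain ⟨i, hi, rfl⟩ := List.mem_iff_getElem.1 (List.mem_of_getLast? hlast)
  exact hl.derives i hi

theorem IsProof.append (h₁ : H.IsProof G l₁) (h₂ : H.IsProof G l₂) :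
    H.IsProof G (l₁ ++ l₂) := by
  intro i hi
  by_cases hlt : i < l₁.length
  · rw [List.getElem_append_left hlt]
    refine (h₁ i hlt).imp_right (Or.imp_right ?_)
    rintro ⟨r, hr, σ, e, hp⟩
    refine ⟨r, hr, σ, e, fun δ hδ => ?_⟩
    obtain ⟨j, hj, e'⟩ := hp δ hδ
    exact ⟨j, hj, by rw [List.getElem_append_left (hj.trans hlt), e']⟩
  · have hle : l₁.length ≤ i := not_lt.1 hlt
    have hi' : i - l₁.length < l₂.length := by simp at hi; omega
    rw [List.getElem_append_right hle]
    refine (h₂ _ hi').imp_right (Or.imp_right ?_)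
    rintro ⟨r, hr, σ, e, hp⟩
    refine ⟨r, hr, σ, e, fun δ hδ => ?_⟩
    obtain ⟨j, hj, e'⟩ := hp δ hδ
    -- Premises cited in the second proof move by the length of the first.
    refine ⟨l₁.length + j, by omega, ?_⟩
    rw [List.getElem_append_right (Nat.le_add_right _ _)]
    simpa using e'

theorem IsProof.concat {l : List Fm} {φ : Fm} (h : H.IsProof G l)
    (hφ : φ ∈ G ∨ (∃ ψ ∈ H.axs, ∃ σ : ℕ → Fm, φ = ψ.subst σ) ∨
      ∃ r ∈ H.rules, ∃ σ : ℕ → Fm, φ = r.2.subst σ ∧ ∀ δ ∈ r.1, δ.subst σ ∈ l) :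
    H.IsProof G (l ++ [φ]) := by
  intro i hi
  by_cases hlt : i < l.length
  · rw [List.getElem_append_left hlt]
    refine (h i hlt).imp_right (Or.imp_right ?_)
    rintro ⟨r, hr, σ, e, hp⟩
    refine ⟨r, hr, σ, e, fun δ hδ => ?_⟩
    obtain ⟨j, hj, e'⟩ := hp δ hδ
    exact ⟨j, hj, by rw [List.getElem_append_left (hj.trans hlt), e']⟩
  · obtain rfl : i = l.length := by simp at hi; omega
    rw [List.getElem_concat_length rfl]
    refine hφ.imp_right (Or.imp_right ?_)
    rintro ⟨r, hr, σ, e, hp⟩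
    refine ⟨r, hr, σ, e, fun δ hδ => ?_⟩
    obtain ⟨j, hj, e'⟩ := List.mem_iff_getElem.1 (hp δ hδ)
    exact ⟨j, hj, by rw [List.getElem_append_left hj, e']⟩

theorem exists_isProof_of_finite {S : Set Fm} (hS : S.Finite)
    (h : ∀ φ ∈ S, H.Proves G φ) : ∃ l, H.IsProof G l ∧ ∀ φ ∈ S, φ ∈ l := by
  induction S, hS using Set.Finite.induction_on with
  | empty => exact ⟨[], fun i hi => absurd hi (Nat.not_lt_zero i), by simp⟩
  | @insert a S _ _ ih =>
    obtain ⟨l, hl, hmem⟩ := ih fun φ hφ => h φ (Set.mem_insert_of_mem _ hφ)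
    obtain ⟨m, hm, hlast⟩ := h a (Set.mem_insert _ _)
    refine ⟨m ++ l, hm.append hl, ?_⟩
    rintro φ (rfl | hφ)
    · exact List.mem_append_left _ (List.mem_of_getLast? hlast)
    · exact List.mem_append_right _ (hmem φ hφ)

/-- A single list must contain proofs of all premises of a rule, which is why the premise sets have
to be finite. -/
theorem Derives.proves (hfin : ∀ r ∈ H.rules, r.1.Finite) {φ : Fm} (h : H.Derives G φ) :
    H.Proves G φ := by
  have nil : H.IsProof G [] := fun i hi => absurd hi (Nat.not_lt_zero i)
  induction h with
  | hyp h => exact ⟨_, nil.concat (.inl h), List.getLast?_concat⟩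
  | ax hψ σ => exact ⟨_, nil.concat (.inr (.inl ⟨_, hψ, σ, rfl⟩)), List.getLast?_concat⟩
  | @rule r hr σ _ ih =>
    obtain ⟨l, hl, hmem⟩ := exists_isProof_of_finite (S := Formula.subst σ '' r.1)
      ((hfin r hr).image _) (by rintro _ ⟨δ, hδ, rfl⟩; exact ih δ hδ)
    exact ⟨_, hl.concat (.inr (.inr ⟨r, hr, σ, rfl, fun δ hδ => hmem _ ⟨δ, hδ, rfl⟩⟩)),
      List.getLast?_concat⟩

theorem Proves.finitary {φ : Fm} (h : H.Proves G φ) :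
    ∃ G' ⊆ G, G'.Finite ∧ H.Proves G' φ := by
  obtain ⟨l, hl, hlast⟩ := h
  -- The finite subset consists of the hypotheses that occur in the proof.
  refine ⟨{ψ | ψ ∈ G ∧ ψ ∈ l}, fun ψ hψ => hψ.1,
    l.finite_toSet.subset fun ψ hψ => hψ.2, l, fun i hi => ?_, hlast⟩
  exact (hl i hi).imp_left fun hG => ⟨hG, List.getElem_mem hi⟩

end HilbertSystem

/-! ### Arithmetic of semi-Heyting algebras -/

namespace IsSemiHeyting

variable {A : Type u} [LAlgebra A]

/-- The lattice reduct. -/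
abbrev lattice (h : IsSemiHeyting A) : Lattice A :=
  Lattice.mk' h.sup_comm h.sup_assoc h.inf_comm h.inf_assoc h.sup_inf_self h.inf_sup_self

theorem inf_self (h : IsSemiHeyting A) (x : A) : x ⊓ x = x := by
  let _ := h.lattice
  exact inf_idem x

theorem inf_impH (h : IsSemiHeyting A) (x y : A) : x ⊓ (x →ₕ y) = x ⊓ y := by
  rw [impH, h.inf_imp, ← h.inf_assoc, h.inf_self]

/-- The implication `→ₕ` is the residual of the meet. -/
theorem inf_impH_eq_left_iff (h : IsSemiHeyting A) (x y z : A) :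
    x ⊓ (y →ₕ z) = x ↔ (x ⊓ y) ⊓ z = x ⊓ y := by
  constructor
  · intro e
    conv_lhs => rw [← e, h.inf_assoc x, h.inf_comm _ y, h.inf_impH, h.inf_assoc x, h.inf_assoc y,
      h.inf_self]
    conv_rhs => rw [← e, h.inf_assoc x, h.inf_comm _ y, h.inf_impH]
  · intro e
    -- Relativized to `x`, both sides of the implication become `x ⊓ y`, so it collapses to `⊤`.
    rw [impH, h.inf_imp_inf, ← h.inf_assoc, e, h.imp_self, h.inf_top]

theorem impH_eq_top_iff (h : IsSemiHeyting A) (x y : A) : x →ₕ y = ⊤ ↔ x ⊓ y = x := by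
  constructor
  · intro e
    rw [← h.inf_impH, e, h.inf_top]
  · intro e
    rw [impH, e, h.imp_self]

/-- This turns each axiom of the form `↔ₕ` into an equation between its two sides. -/
theorem iffH_eq_top_iff (h : IsSemiHeyting A) (x y : A) : x ↔ₕ y = ⊤ ↔ x = y := by
  constructor
  · intro e
    have e₁ : x →ₕ y = ⊤ := by
      rw [← h.inf_top (x →ₕ y), ← e, iffH, ← h.inf_assoc, h.inf_self]
    have e₂ : y →ₕ x = ⊤ := by
      rw [← h.inf_top (y →ₕ x), ← e, iffH, h.inf_comm (x →ₕ y), ← h.inf_assoc, h.inf_self]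
    rw [← (h.impH_eq_top_iff x y).1 e₁, h.inf_comm, (h.impH_eq_top_iff y x).1 e₂]
  · rintro rfl
    rw [iffH, (h.impH_eq_top_iff x x).2 (h.inf_self x), h.inf_self]

theorem impH_self (h : IsSemiHeyting A) (x : A) : x →ₕ x = ⊤ :=
  (h.impH_eq_top_iff x x).2 (h.inf_self x)

/-- The two implications between elements that agree below `u`. -/
theorem inf_imp_congr (h : IsSemiHeyting A) {u a b c d : A} (hab : u ⊓ a = u ⊓ b)
    (hcd : u ⊓ c = u ⊓ d) : u ⊓ (a ⇨ c) = u ⊓ (b ⇨ d) := by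
  rw [h.inf_imp_inf, hab, hcd, ← h.inf_imp_inf]

/-- Every axiom of semi-Heyting logic is true in every semi-Heyting algebra. -/
theorem eval_eq_top (h : IsSemiHeyting A) {φ : Fm} (hφ : φ ∈ semiHeytingAxs) (v : ℕ → A) :
    φ.eval v = ⊤ := by
  let _ := h.lattice
  have top : ∀ x y : A, x →ₕ y = ⊤ ↔ x ≤ y := fun x y =>
    (h.impH_eq_top_iff x y).trans inf_eq_left
  have res : ∀ x y z : A, x ≤ y →ₕ z ↔ x ⊓ y ≤ z := fun x y z => by
    rw [← inf_eq_left, ← inf_eq_left]; exact h.inf_impH_eq_left_iff x y z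
  have mp : ∀ x y : A, x ⊓ (x →ₕ y) ≤ y := fun x y => by
    rw [_root_.inf_comm]; exact (res _ _ _).1 le_rfl
  have agree : ∀ {u x y : A}, u ≤ x →ₕ y → u ≤ y →ₕ x → u ⊓ x = u ⊓ y := fun h₁ h₂ =>
    le_antisymm (le_inf inf_le_left ((res _ _ _).1 h₁)) (le_inf inf_le_left ((res _ _ _).1 h₂))
  have ant : ∀ a b c : A, (a →ₕ b) →ₕ ((b →ₕ a) →ₕ ((a ⇨ c) →ₕ (b ⇨ c))) = ⊤ := fun a b c => by
    rw [top, res, res]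
    refine (inf_imp_congr h (agree ?_ ?_) rfl).le.trans inf_le_right
    exacts [inf_le_left, inf_le_right]
  have con : ∀ a b c : A, (a →ₕ b) →ₕ ((b →ₕ a) →ₕ ((c ⇨ b) →ₕ (c ⇨ a))) = ⊤ := fun a b c => by
    rw [top, res, res]
    refine (inf_imp_congr h rfl (agree ?_ ?_)).le.trans inf_le_right
    exacts [inf_le_right, inf_le_left]
  rcases hφ with rfl | rfl | rfl | rfl | rfl | rfl | rfl | rfl | rfl | rfl | rfl
  · exact (top _ _).2 le_sup_left
  · exact (top _ _).2 le_sup_right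
  · refine (top (v 0 →ₕ v 2) ((v 1 →ₕ v 2) →ₕ ((v 0 ⊔ v 1) →ₕ v 2))).2 ?_
    -- Residuation moves the join alone to the left, so that `sup_le` applies and distributivity is
    -- not needed.
    rw [res, res, _root_.inf_comm, ← res]
    refine sup_le ?_ ?_
    · rw [res, _root_.inf_comm, ← res]
      exact inf_le_left
    · rw [res, _root_.inf_comm, ← res]
      exact inf_le_right
  · exact (top (v 0 ⊓ v 1) (v 0)).2 inf_le_left
  · refine (top (v 2 →ₕ v 0) ((v 2 →ₕ v 1) →ₕ (v 2 →ₕ (v 0 ⊓ v 1)))).2 ?_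
    rw [res, res]
    refine le_inf ?_ ?_
    · rw [← res]
      exact inf_le_left
    · rw [← res]
      exact inf_le_right
  · rfl
  · exact (top ⊥ (v 0)).2 (inf_eq_left.1 (h.bot_inf _))
  · refine (top ((v 0 ⊓ v 1) →ₕ v 2) (v 0 →ₕ (v 1 →ₕ v 2))).2 ?_
    rw [res, res, _root_.inf_assoc, ← res]
  · refine (top (v 0 →ₕ (v 1 →ₕ v 2)) ((v 0 ⊓ v 1) →ₕ v 2)).2 ?_
    rw [res, ← _root_.inf_assoc, ← res, ← res]
  · exact ant _ _ _
  · exact con _ _ _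

end IsSemiHeyting

/-! ### Soundness -/

theorem IsDMSH.dm_sup {A : Type u} [LAlgebra A] (h : IsDMSH A) (x y : A) :
    dm (x ⊔ y) = dm x ⊓ dm y := by
  rw [← h.dm_dm (dm x ⊓ dm y), h.dm_inf, h.dm_dm, h.dm_dm]

theorem IsRUNO1.eval_eq_top {A : Type u} [LAlgebra A] (h : IsRUNO1 A) {φ : Fm}
    (hφ : φ ∈ runo1Logic.axs) (v : ℕ → A) : φ.eval v = ⊤ := by
  have sh := h.toIsSemiHeyting
  rcases hφ with (hφ | hφ) | hφ
  · exact sh.eval_eq_top hφ v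
  · rcases hφ with rfl | rfl | rfl | rfl
    · exact (sh.iffH_eq_top_iff _ _).2 h.dm_bot.symm
    · exact (sh.iffH_eq_top_iff _ _).2 (h.dm_inf _ _)
    · exact (sh.iffH_eq_top_iff _ _).2 (h.dm_sup _ _)
    · exact (sh.iffH_eq_top_iff _ _).2 (h.dm_dm _)
  · rcases hφ with rfl | rfl | rfl
    · exact (sh.iffH_eq_top_iff _ _).2 h.unorthodox
    · refine (sh.iffH_eq_top_iff _ _).2 ?_
      let _ := sh.lattice
      exact sup_eq_right.2 (inf_eq_left.1 (h.regular (v 0) (v 1)))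
    · exact (sh.iffH_eq_top_iff _ _).2 (h.level_one _).symm

theorem IsRUNO1.eval_eq_top_of_derives {A : Type u} [LAlgebra A] (h : IsRUNO1 A) {G : Set Fm}
    {φ : Fm} (hφ : runo1Logic.Derives G φ) (v : ℕ → A) (hG : ∀ γ ∈ G, γ.eval v = ⊤) :
    φ.eval v = ⊤ := by
  have sh := h.toIsSemiHeyting
  induction hφ with
  | hyp hφ => exact hG _ hφ
  | ax hψ σ => rw [Formula.eval_subst]; exact h.eval_eq_top hψ _
  | rule hr σ _ ih =>
    rcases hr with rfl | rfl
    · have e₁ := ih _ (Or.inl rfl)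
      have e₂ := (sh.impH_eq_top_iff ((σ 0).eval v) ((σ 1).eval v)).1 (ih _ (Or.inr rfl))
      change (σ 0).eval v = ⊤ at e₁
      change (σ 1).eval v = ⊤
      rwa [e₁, sh.inf_comm, sh.inf_top] at e₂
    · have e := (sh.impH_eq_top_iff ((σ 0).eval v) ((σ 1).eval v)).1 (ih _ rfl)
      refine (sh.impH_eq_top_iff (dm ((σ 1).eval v)) (dm ((σ 0).eval v))).2 ?_
      -- The meet of the negations is the negation of a join, which absorption simplifies.
      rw [← h.dm_sup, ← e, sh.inf_comm, sh.sup_inf_self]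

/-! ### Derivations in the logic -/

namespace RUNO1

variable {G : Set Fm} {a b c d : Fm}

/-- The substitution of `a`, `b`, `c` for the first three variables. -/
def subst₃ (a b c : Fm) : ℕ → Fm
  | 0 => a
  | 1 => b
  | _ => c

local notation G " ⊩ " φ:45 => HilbertSystem.Derives runo1Logic G φ

theorem of_semiHeytingAxs {ψ : Fm} (hψ : ψ ∈ semiHeytingAxs) (a b c : Fm) :
    G ⊩ ψ.subst (subst₃ a b c) :=
  .ax (H := runo1Logic) (.inl (.inl hψ)) _

theorem of_deMorganAxs {ψ : Fm} (hψ : ψ ∈ deMorganAxs) (a b : Fm) :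
    G ⊩ ψ.subst (subst₃ a b a) :=
  .ax (H := runo1Logic) (.inl (.inr hψ)) _

theorem of_runo1Axs {ψ : Fm} (hψ : ψ ∈ runo1Axs) (a b : Fm) :
    G ⊩ ψ.subst (subst₃ a b a) :=
  .ax (H := runo1Logic) (.inr hψ) _

theorem mp (h₁ : G ⊩ a →ₕ b) (h₂ : G ⊩ a) : G ⊩ b :=
  .rule (H := runo1Logic) (r := ({.var 0, .var 0 →ₕ .var 1}, .var 1)) (.inl rfl) (subst₃ a b b) <| by
    rintro δ (rfl | rfl)
    exacts [h₂, h₁]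

theorem dm_anti (h : G ⊩ a →ₕ b) : G ⊩ dm b →ₕ dm a :=
  .rule (H := runo1Logic) (r := ({(.var 0 : Fm) →ₕ .var 1}, dm (.var 1 : Fm) →ₕ dm (.var 0))) (.inr rfl) (subst₃ a b b) <| by
    rintro δ rfl
    exact h

theorem le_sup_left : G ⊩ a →ₕ (a ⊔ b) :=
  of_semiHeytingAxs (.inl rfl) a b a

theorem le_sup_right : G ⊩ b →ₕ (a ⊔ b) :=
  of_semiHeytingAxs (.inr (.inl rfl)) a b a

theorem sup_le (h₁ : G ⊩ a →ₕ c) (h₂ : G ⊩ b →ₕ c) : G ⊩ (a ⊔ b) →ₕ c :=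
  mp (mp (of_semiHeytingAxs (.inr (.inr (.inl rfl))) a b c) h₁) h₂

theorem inf_le_left : G ⊩ (a ⊓ b) →ₕ a :=
  of_semiHeytingAxs (.inr (.inr (.inr (.inl rfl)))) a b a

theorem le_inf (h₁ : G ⊩ c →ₕ a) (h₂ : G ⊩ c →ₕ b) : G ⊩ c →ₕ (a ⊓ b) :=
  mp (mp (of_semiHeytingAxs (.inr (.inr (.inr (.inr (.inl rfl))))) a b c) h₁) h₂

theorem top : G ⊩ ⊤ :=
  of_semiHeytingAxs (.inr (.inr (.inr (.inr (.inr (.inl rfl)))))) ⊤ ⊤ ⊤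

theorem bot_le : G ⊩ ⊥ →ₕ a :=
  of_semiHeytingAxs (.inr (.inr (.inr (.inr (.inr (.inr (.inl rfl))))))) a a a

theorem curry_le : G ⊩ ((a ⊓ b) →ₕ c) →ₕ (a →ₕ (b →ₕ c)) :=
  of_semiHeytingAxs (.inr (.inr (.inr (.inr (.inr (.inr (.inr (.inl rfl)))))))) a b c

theorem uncurry_le : G ⊩ (a →ₕ (b →ₕ c)) →ₕ ((a ⊓ b) →ₕ c) :=
  of_semiHeytingAxs (.inr (.inr (.inr (.inr (.inr (.inr (.inr (.inr (.inl rfl))))))))) a b c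

theorem imp_congr_left_le :
    G ⊩ (a →ₕ b) →ₕ ((b →ₕ a) →ₕ ((a ⇨ c) →ₕ (b ⇨ c))) :=
  of_semiHeytingAxs
    (.inr (.inr (.inr (.inr (.inr (.inr (.inr (.inr (.inr (.inl rfl)))))))))) a b c

theorem imp_congr_right_le :
    G ⊩ (a →ₕ b) →ₕ ((b →ₕ a) →ₕ ((c ⇨ b) →ₕ (c ⇨ a))) :=
  of_semiHeytingAxs
    (.inr (.inr (.inr (.inr (.inr (.inr (.inr (.inr (.inr (.inr rfl)))))))))) a b c

/-! ### The order calculus of `→ₕ` -/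

theorem curry (h : G ⊩ (a ⊓ b) →ₕ c) : G ⊩ a →ₕ (b →ₕ c) := mp curry_le h

theorem uncurry (h : G ⊩ a →ₕ (b →ₕ c)) : G ⊩ (a ⊓ b) →ₕ c := mp uncurry_le h

theorem weaken (h : G ⊩ a) : G ⊩ b →ₕ a := mp (curry inf_le_left) h

theorem imp_of_equiv (h₁ : G ⊩ a →ₕ b) (h₂ : G ⊩ b →ₕ a) (h : G ⊩ c ⇨ b) : G ⊩ c ⇨ a :=
  mp (mp (mp imp_congr_right_le h₁) h₂) h

/-- `φ →ₕ ⊤` unfolds to `φ ⇨ (φ ⊓ ⊤)`, whose consequent is equivalent to `φ ⊓ φ`. -/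
theorem le_refl (φ : Fm) : G ⊩ φ →ₕ φ :=
  imp_of_equiv (b := φ ⊓ ⊤) (le_inf inf_le_left (weaken top)) (le_inf inf_le_left inf_le_left)
    (weaken top : G ⊩ φ →ₕ ⊤)

theorem inf_le_right : G ⊩ (a ⊓ b) →ₕ b := uncurry (weaken (le_refl b))

/-- Transitivity in the case of an equivalence on the right. -/
theorem le_of_le_of_equiv (h : G ⊩ a →ₕ b) (h₁ : G ⊩ b →ₕ c) (h₂ : G ⊩ c →ₕ b) : G ⊩ a →ₕ c :=
  imp_of_equiv (le_inf inf_le_left (uncurry (weaken h₂))) (le_inf inf_le_left (uncurry (weaken h₁)))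
    h

/-- Composing two projections would need transitivity. Currying is an equivalence, though, so the
projection from `a ⊓ (b ⊓ c)` can be curried step by step and reassembled. -/
theorem inf_inf_le : G ⊩ ((a ⊓ b) ⊓ c) →ₕ a :=
  uncurry (uncurry (le_of_le_of_equiv (curry inf_le_left) curry_le uncurry_le))

theorem inf_le_of_left_le (h : G ⊩ a →ₕ b) : G ⊩ (a ⊓ c) →ₕ b :=
  imp_of_equiv (le_inf inf_le_left inf_inf_le) (le_inf inf_le_left (uncurry (weaken h)))
    (inf_le_left : G ⊩ (a ⊓ c) →ₕ a)

/-- The two hypotheses make `a ⊓ b` and `a ⊓ c` equivalent, and these are the consequents inside `a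
→ₕ b` and `a →ₕ c`. -/
theorem le_trans (h₁ : G ⊩ a →ₕ b) (h₂ : G ⊩ b →ₕ c) : G ⊩ a →ₕ c :=
  imp_of_equiv (le_inf inf_le_left (inf_le_of_left_le h₁))
    (le_inf inf_le_left (uncurry (weaken h₂))) h₁

theorem inf_mono (h₁ : G ⊩ a →ₕ b) (h₂ : G ⊩ c →ₕ d) : G ⊩ (a ⊓ c) →ₕ (b ⊓ d) :=
  le_inf (le_trans inf_le_left h₁) (le_trans inf_le_right h₂)

theorem sup_mono (h₁ : G ⊩ a →ₕ b) (h₂ : G ⊩ c →ₕ d) : G ⊩ (a ⊔ c) →ₕ (b ⊔ d) :=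
  sup_le (le_trans h₁ le_sup_left) (le_trans h₂ le_sup_right)

theorem le_mp {u : Fm} (h₁ : G ⊩ u →ₕ (a →ₕ b)) (h₂ : G ⊩ u →ₕ a) : G ⊩ u →ₕ b :=
  le_trans (le_inf (le_refl u) h₂) (uncurry h₁)

/-- Implications between formulas that are equivalent below `u`. -/
theorem le_imp_congr {u : Fm} (h₁ : G ⊩ u →ₕ (a →ₕ b)) (h₂ : G ⊩ u →ₕ (b →ₕ a))
    (h₃ : G ⊩ u →ₕ (c →ₕ d)) (h₄ : G ⊩ u →ₕ (d →ₕ c)) (h : G ⊩ u →ₕ (a ⇨ c)) :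
    G ⊩ u →ₕ (b ⇨ d) :=
  le_mp (le_mp (le_mp (weaken imp_congr_right_le) h₄) h₃)
    (le_mp (le_mp (le_mp (weaken imp_congr_left_le) h₁) h₂) h)

/-- Provable equivalence from `G`, on formulas lifted to the universe of the algebras. -/
def setoid (G : Set Fm) : Setoid (ULift.{u} Fm) where
  r a b := (G ⊩ a.down →ₕ b.down) ∧ (G ⊩ b.down →ₕ a.down)
  iseqv :=
    { refl := fun _ => ⟨le_refl _, le_refl _⟩
      symm := fun h => ⟨h.2, h.1⟩
      trans := fun h k => ⟨le_trans h.1 k.1, le_trans k.2 h.2⟩ }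

/-- The Lindenbaum–Tarski algebra of the theory generated by `G`. -/
def Lindenbaum (G : Set Fm) : Type u := Quotient (setoid.{u} G)

/-- The class of a formula. -/
def Lindenbaum.mk (G : Set Fm) (φ : Fm) : Lindenbaum.{u} G := Quotient.mk (setoid G) ⟨φ⟩

instance (G : Set Fm) : LAlgebra (Lindenbaum.{u} G) where
  max := Quotient.map₂ (fun a b => ⟨a.down ⊔ b.down⟩) fun _ _ h _ _ k =>
    ⟨sup_mono h.1 k.1, sup_mono h.2 k.2⟩
  min := Quotient.map₂ (fun a b => ⟨a.down ⊓ b.down⟩) fun _ _ h _ _ k =>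
    ⟨inf_mono h.1 k.1, inf_mono h.2 k.2⟩
  -- The relative congruence is used with `u` equal to the implication being rewritten.
  himp := Quotient.map₂ (fun a b => ⟨a.down ⇨ b.down⟩) fun _ _ h _ _ k =>
    ⟨le_imp_congr (weaken h.1) (weaken h.2) (weaken k.1) (weaken k.2) (le_refl _),
      le_imp_congr (weaken h.2) (weaken h.1) (weaken k.2) (weaken k.1) (le_refl _)⟩
  bot := Lindenbaum.mk G ⊥
  top := Lindenbaum.mk G ⊤
  dm := Quotient.map (fun a => ⟨dm a.down⟩) fun _ _ h => ⟨dm_anti h.2, dm_anti h.1⟩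

theorem Lindenbaum.mk_eq (h₁ : G ⊩ a →ₕ b) (h₂ : G ⊩ b →ₕ a) :
    Lindenbaum.mk.{u} G a = Lindenbaum.mk G b :=
  Quotient.sound ⟨h₁, h₂⟩

theorem Lindenbaum.mk_eq_of_iffH (h : G ⊩ a ↔ₕ b) :
    Lindenbaum.mk.{u} G a = Lindenbaum.mk G b :=
  mk_eq (mp inf_le_left h) (mp inf_le_right h)

/-- Links truth in the quotient to derivability; completeness is this statement under the canonical
interpretation. -/
theorem Lindenbaum.mk_eq_top_iff : Lindenbaum.mk.{u} G a = ⊤ ↔ G ⊩ a := by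
  constructor
  · intro h
    exact mp (Quotient.exact h).2 top
  · intro h
    exact mk_eq (weaken top) (weaken h)

theorem Lindenbaum.exists_mk (x : Lindenbaum.{u} G) : ∃ a, Lindenbaum.mk G a = x :=
  Quotient.inductionOn x fun a => ⟨a.down, rfl⟩

theorem Lindenbaum.eval_mk_var (φ : Fm) :
    φ.eval (fun n => Lindenbaum.mk.{u} G (.var n)) = Lindenbaum.mk G φ := by
  induction φ with
  | var x => rfl
  | or a b iha ihb => exact congrArg₂ (· ⊔ ·) iha ihb
  | and a b iha ihb => exact congrArg₂ (· ⊓ ·) iha ihb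
  | imp a b iha ihb => exact congrArg₂ (· ⇨ ·) iha ihb
  | neg a ih => exact congrArg dm ih
  | bot => rfl
  | top => rfl

/-! ### The laws of the Lindenbaum–Tarski algebra -/

theorem le_inf_equiv : G ⊩ a →ₕ (b →ₕ (a ⊓ b)) := curry (le_refl _)

/-- Below `a`, each formula is equivalent to its meet with `a`. -/
theorem inf_imp_le : G ⊩ (a ⊓ (b ⇨ c)) →ₕ ((a ⊓ b) ⇨ (a ⊓ c)) :=
  le_imp_congr (le_trans inf_le_left le_inf_equiv) (weaken inf_le_right)
    (le_trans inf_le_left le_inf_equiv) (weaken inf_le_right) inf_le_right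

theorem inf_imp_ge : G ⊩ (a ⊓ ((a ⊓ b) ⇨ (a ⊓ c))) →ₕ (b ⇨ c) :=
  le_imp_congr (weaken inf_le_right) (le_trans inf_le_left le_inf_equiv)
    (weaken inf_le_right) (le_trans inf_le_left le_inf_equiv) inf_le_right

theorem imp_self : G ⊩ a ⇨ a :=
  imp_of_equiv (le_inf (le_refl a) (le_refl a)) inf_le_left (le_refl a)

theorem inf_imp_le_right : G ⊩ (a ⊓ (a ⇨ b)) →ₕ b :=
  -- After `a ⊓ a` is replaced by `a`, the implication `a ⇨ (a ⊓ b)` is `a →ₕ b` by definition.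
  le_mp (le_imp_congr (weaken inf_le_left) (weaken (le_inf (le_refl _) (le_refl _)))
    (weaken (le_refl _)) (weaken (le_refl _)) inf_imp_le) inf_le_left

/-- Below `a ⊓ b` the formulas `a` and `b` are equivalent, so `a ⇨ a` becomes `a ⇨ b`. -/
theorem inf_le_imp : G ⊩ (a ⊓ b) →ₕ (a ⇨ b) :=
  le_imp_congr (weaken (le_refl a)) (weaken (le_refl a))
    (le_trans inf_le_right (curry inf_le_left)) (le_trans inf_le_left (curry inf_le_left))
    (weaken imp_self)

open Lindenbaum in
theorem Lindenbaum.isSemiHeyting (G : Set Fm) : IsSemiHeyting (Lindenbaum.{u} G) := by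
  constructor
  case inf_comm =>
    intro x y
    obtain ⟨a, rfl⟩ := exists_mk x
    obtain ⟨b, rfl⟩ := exists_mk y
    exact mk_eq (le_inf inf_le_right inf_le_left) (le_inf inf_le_right inf_le_left)
  case sup_comm =>
    intro x y
    obtain ⟨a, rfl⟩ := exists_mk x
    obtain ⟨b, rfl⟩ := exists_mk y
    exact mk_eq (sup_le le_sup_right le_sup_left) (sup_le le_sup_right le_sup_left)
  case inf_assoc =>
    intro x y z
    obtain ⟨a, rfl⟩ := exists_mk x
    obtain ⟨b, rfl⟩ := exists_mk y
    obtain ⟨c, rfl⟩ := exists_mk z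
    exact mk_eq (le_inf inf_inf_le (inf_mono inf_le_right (le_refl c)))
      (le_inf (inf_mono (le_refl a) inf_le_left) (le_trans inf_le_right inf_le_right))
  case sup_assoc =>
    intro x y z
    obtain ⟨a, rfl⟩ := exists_mk x
    obtain ⟨b, rfl⟩ := exists_mk y
    obtain ⟨c, rfl⟩ := exists_mk z
    exact mk_eq
      (sup_le (sup_mono (le_refl a) le_sup_left) (le_trans le_sup_right le_sup_right))
      (sup_le (le_trans le_sup_left le_sup_left) (sup_mono le_sup_right (le_refl c)))
  case inf_sup_self =>
    intro x y
    obtain ⟨a, rfl⟩ := exists_mk x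
    obtain ⟨b, rfl⟩ := exists_mk y
    exact mk_eq inf_le_left (le_inf (le_refl a) le_sup_left)
  case sup_inf_self =>
    intro x y
    obtain ⟨a, rfl⟩ := exists_mk x
    obtain ⟨b, rfl⟩ := exists_mk y
    exact mk_eq (sup_le (le_refl a) inf_le_left) le_sup_left
  case bot_inf =>
    intro x
    obtain ⟨a, rfl⟩ := exists_mk x
    exact mk_eq inf_le_left bot_le
  case inf_top =>
    intro x
    obtain ⟨a, rfl⟩ := exists_mk x
    exact mk_eq inf_le_left (le_inf (le_refl a) (weaken top))
  case inf_imp =>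
    intro x y
    obtain ⟨a, rfl⟩ := exists_mk x
    obtain ⟨b, rfl⟩ := exists_mk y
    exact mk_eq (le_inf inf_le_left inf_imp_le_right) (le_inf inf_le_left inf_le_imp)
  case inf_imp_inf =>
    intro x y z
    obtain ⟨a, rfl⟩ := exists_mk x
    obtain ⟨b, rfl⟩ := exists_mk y
    obtain ⟨c, rfl⟩ := exists_mk z
    exact mk_eq (le_inf inf_le_left inf_imp_le) (le_inf inf_le_left inf_imp_ge)
  case imp_self =>
    intro x
    obtain ⟨a, rfl⟩ := exists_mk x
    exact mk_eq_top_iff.2 imp_self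

open Lindenbaum in
theorem Lindenbaum.isRUNO1 (G : Set Fm) : IsRUNO1 (Lindenbaum.{u} G) := by
  have sh := isSemiHeyting.{u} G
  have dm_bot : dm (⊥ : Lindenbaum.{u} G) = ⊤ :=
    (mk_eq_of_iffH (of_deMorganAxs (.inl rfl) ⊤ ⊤)).symm
  have dm_dm : ∀ x : Lindenbaum.{u} G, dm (dm x) = x := fun x => by
    obtain ⟨a, rfl⟩ := exists_mk x
    exact mk_eq_of_iffH (of_deMorganAxs (.inr (.inr (.inr rfl))) a a)
  have dm_inf : ∀ x y : Lindenbaum.{u} G, dm (x ⊓ y) = dm x ⊔ dm y := fun x y => by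
    obtain ⟨a, rfl⟩ := exists_mk x
    obtain ⟨b, rfl⟩ := exists_mk y
    exact mk_eq_of_iffH (of_deMorganAxs (.inr (.inl rfl)) a b)
  have unorthodox : dm ((⊥ : Lindenbaum.{u} G) ⇨ ⊤) = ⊥ ⇨ ⊤ :=
    mk_eq_of_iffH (of_runo1Axs (.inl rfl) ⊤ ⊤)
  have regular : ∀ x y : Lindenbaum.{u} G,
      (x ⊓ dm (pseudo (dm x))) ⊓ (y ⊔ pseudo y) = x ⊓ dm (pseudo (dm x)) := fun x y => by
    obtain ⟨a, rfl⟩ := exists_mk x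
    obtain ⟨b, rfl⟩ := exists_mk y
    exact mk_eq inf_le_left (le_inf (le_refl _)
      (le_trans le_sup_left (mp inf_le_left (of_runo1Axs (.inr (.inl rfl)) a b))))
  have level_one : ∀ x : Lindenbaum.{u} G,
      x ⊓ pseudo (dm x) = pseudo (dm (x ⊓ pseudo (dm x))) := fun x => by
    obtain ⟨a, rfl⟩ := exists_mk x
    exact (mk_eq_of_iffH (of_runo1Axs (.inr (.inr rfl)) a a)).symm
  -- The remaining laws for `dm` follow from the involution.
  exact
    { sh with
      dm_bot := dm_bot
      dm_top := by rw [← dm_bot, dm_dm]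
      dm_inf := dm_inf
      dm_dm_sup := fun x y => by rw [dm_dm, dm_dm, dm_dm]
      dm_dm_le := fun x => by rw [dm_dm, sh.inf_self]
      dm_dm := dm_dm
      unorthodox := unorthodox
      regular := regular
      level_one := level_one }

/-! ### Completeness and algebraizability -/

theorem proves_iff_derives {φ : Fm} : runo1Logic.Proves G φ ↔ G ⊩ φ := by
  refine ⟨fun h => h.derives, fun h => h.proves ?_⟩
  rintro r (rfl | rfl)
  · exact Set.toFinite _
  · exact Set.finite_singleton _

theorem proves_iff_forall_eval_eq_top {φ : Fm} :
    runo1Logic.Proves G φ ↔ ∀ (A : Type u) [LAlgebra A], IsRUNO1 A →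
      ∀ v : ℕ → A, (∀ γ ∈ G, γ.eval v = ⊤) → φ.eval v = ⊤ := by
  rw [proves_iff_derives]
  refine ⟨fun h A _ hA v hG => hA.eval_eq_top_of_derives h v hG, fun h => ?_⟩
  have e := h (Lindenbaum.{u} G) (Lindenbaum.isRUNO1 G) (fun n => Lindenbaum.mk G (.var n))
    fun γ hγ => by rw [Lindenbaum.eval_mk_var, Lindenbaum.mk_eq_top_iff]; exact .hyp hγ
  rwa [Lindenbaum.eval_mk_var, Lindenbaum.mk_eq_top_iff] at e

/-- Monotonicity, cut and structurality are evident for semantic consequence; completeness holds in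
every universe, so universe 0 suffices. -/
theorem isLogic_proves : IsLogic runo1Logic.Proves where
  refl G φ h := proves_iff_derives.2 (.hyp h)
  mono G D φ h hGD := proves_iff_forall_eval_eq_top.{0}.2 fun A _ hA v hD =>
    proves_iff_forall_eval_eq_top.1 h A hA v fun γ hγ => hD γ (hGD hγ)
  cut G D φ h hGD := proves_iff_forall_eval_eq_top.{0}.2 fun A _ hA v hD =>
    proves_iff_forall_eval_eq_top.1 h A hA v fun γ hγ =>
      proves_iff_forall_eval_eq_top.1 (hGD γ hγ) A hA v hD
  finitary G φ h := h.finitary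
  structural σ G φ h := proves_iff_forall_eval_eq_top.{0}.2 fun A _ hA v hG => by
    rw [Formula.eval_subst]
    refine proves_iff_forall_eval_eq_top.1 h A hA _ fun γ hγ => ?_
    rw [← Formula.eval_subst]
    exact hG _ ⟨γ, hγ, rfl⟩

/-! ### The variety, and the choices of `E` and `D` -/

theorem isVariety : IsVariety.{u} RUNO1Class := by
  -- The defining set is the whole equational theory of the class; it contains every defining law,
  -- and each law is recovered by evaluating at suitable variables.
  refine ⟨{e | ∀ (A : Type u) [LAlgebra A], IsRUNO1 A → e.ValidIn A}, fun A _ =>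
    ⟨fun hA e he => he A hA, fun h => ?_⟩⟩
  let val (x y z : A) : ℕ → A := fun n => match n with
    | 0 => x
    | 1 => y
    | _ => z
  let p : Fm := .var 0
  let q : Fm := .var 1
  let r : Fm := .var 2
  exact
    { inf_comm := fun x y =>
        h (p ⊓ q ≈ₗ q ⊓ p) (fun _ _ hB _ => hB.inf_comm _ _) (val x y x)
      sup_comm := fun x y =>
        h (p ⊔ q ≈ₗ q ⊔ p) (fun _ _ hB _ => hB.sup_comm _ _) (val x y x)
      inf_assoc := fun x y z =>
        h ((p ⊓ q) ⊓ r ≈ₗ p ⊓ (q ⊓ r)) (fun _ _ hB _ => hB.inf_assoc _ _ _) (val x y z)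
      sup_assoc := fun x y z =>
        h ((p ⊔ q) ⊔ r ≈ₗ p ⊔ (q ⊔ r)) (fun _ _ hB _ => hB.sup_assoc _ _ _) (val x y z)
      inf_sup_self := fun x y =>
        h (p ⊓ (p ⊔ q) ≈ₗ p) (fun _ _ hB _ => hB.inf_sup_self _ _) (val x y x)
      sup_inf_self := fun x y =>
        h (p ⊔ (p ⊓ q) ≈ₗ p) (fun _ _ hB _ => hB.sup_inf_self _ _) (val x y x)
      bot_inf := fun x => h (⊥ ⊓ p ≈ₗ ⊥) (fun _ _ hB _ => hB.bot_inf _) (val x x x)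
      inf_top := fun x => h (p ⊓ ⊤ ≈ₗ p) (fun _ _ hB _ => hB.inf_top _) (val x x x)
      inf_imp := fun x y =>
        h (p ⊓ (p ⇨ q) ≈ₗ p ⊓ q) (fun _ _ hB _ => hB.inf_imp _ _) (val x y x)
      inf_imp_inf := fun x y z =>
        h (p ⊓ (q ⇨ r) ≈ₗ p ⊓ ((p ⊓ q) ⇨ (p ⊓ r)))
          (fun _ _ hB _ => hB.inf_imp_inf _ _ _) (val x y z)
      imp_self := fun x => h (p ⇨ p ≈ₗ ⊤) (fun _ _ hB _ => hB.imp_self _) (val x x x)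
      dm_bot := h (dm ⊥ ≈ₗ ⊤) (fun _ _ hB _ => hB.dm_bot) (fun _ => ⊥)
      dm_top := h (dm ⊤ ≈ₗ ⊥) (fun _ _ hB _ => hB.dm_top) (fun _ => ⊥)
      dm_inf := fun x y =>
        h (dm (p ⊓ q) ≈ₗ dm p ⊔ dm q) (fun _ _ hB _ => hB.dm_inf _ _) (val x y x)
      dm_dm_sup := fun x y =>
        h (dm (dm (p ⊔ q)) ≈ₗ dm (dm p) ⊔ dm (dm q))
          (fun _ _ hB _ => hB.dm_dm_sup _ _) (val x y x)
      dm_dm_le := fun x =>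
        h (dm (dm p) ⊓ p ≈ₗ dm (dm p)) (fun _ _ hB _ => hB.dm_dm_le _) (val x x x)
      dm_dm := fun x => h (dm (dm p) ≈ₗ p) (fun _ _ hB _ => hB.dm_dm _) (val x x x)
      unorthodox := h (dm (⊥ ⇨ ⊤) ≈ₗ ⊥ ⇨ ⊤) (fun _ _ hB _ => hB.unorthodox) (fun _ => ⊥)
      regular := fun x y =>
        h ((p ⊓ dm (pseudo (dm p))) ⊓ (q ⊔ pseudo q) ≈ₗ p ⊓ dm (pseudo (dm p)))
          (fun _ _ hB _ => hB.regular _ _) (val x y x)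
      level_one := fun x =>
        h (p ⊓ pseudo (dm p) ≈ₗ pseudo (dm (p ⊓ pseudo (dm p))))
          (fun _ _ hB _ => hB.level_one _) (val x x x) }

/-- `E` and `D` witness algebraizability as soon as they express, in the algebras of the class,
truth and equality. -/
theorem isEquivalentAlgebraicSemantics {E : Set (Identity (Fin 1))} {D : Set (Formula (Fin 2))}
    (hE : E.Finite) (hD : D.Finite)
    (hE_iff : ∀ (A : Type u) [LAlgebra A], IsRUNO1 A → ∀ (v : ℕ → A) (φ : Fm),
      (∀ e ∈ instE E φ, e.HoldsAt v) ↔ φ.eval v = ⊤)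
    (hD_iff : ∀ (A : Type u) [LAlgebra A], IsRUNO1 A → ∀ (v : ℕ → A) (φ ψ : Fm),
      (∀ d ∈ D, (d.subst ![φ, ψ]).eval v = ⊤) ↔ φ.eval v = ψ.eval v) :
    IsEquivalentAlgebraicSemantics.{u} runo1Logic.Proves RUNO1Class E D := by
  have hED : ∀ (A : Type u) [LAlgebra A], IsRUNO1 A → ∀ (v : ℕ → A) (φ ψ : Fm),
      (∀ e ∈ instED E D φ ψ, e.HoldsAt v) ↔ φ.eval v = ψ.eval v := by
    intro A _ hA v φ ψ
    rw [← hD_iff A hA v φ ψ]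
    simp only [instED, Set.mem_iUnion₂]
    constructor
    · intro h d hd
      exact (hE_iff A hA v _).1 fun e he => h e ⟨d, hd, he⟩
    · rintro h e ⟨d, hd, he⟩
      exact (hE_iff A hA v _).2 (h d hd) e he
  refine { finite_E := hE, finite_D := hD, iff_consequence := ?_, identity_to_D := ?_,
           D_to_identity := ?_ }
  · intro G φ
    have hG : ∀ (A : Type u) [LAlgebra A], IsRUNO1 A → ∀ v : ℕ → A,
        (∀ s ∈ ⋃ ψ ∈ G, instE E ψ, s.HoldsAt v) ↔ ∀ γ ∈ G, γ.eval v = ⊤ := by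
      intro A _ hA v
      simp only [Set.mem_iUnion₂]
      constructor
      · intro h γ hγ
        exact (hE_iff A hA v γ).1 fun e he => h e ⟨γ, hγ, he⟩
      · rintro h e ⟨γ, hγ, he⟩
        exact (hE_iff A hA v γ).2 (h γ hγ) e he
    rw [proves_iff_forall_eval_eq_top.{u}]
    constructor
    · intro h e he A _ hA v hv
      exact (hE_iff A hA v φ).2 (h A hA v ((hG A hA v).1 hv)) e he
    · intro h A _ hA v hv
      exact (hE_iff A hA v φ).1 fun e he => h e he A hA v ((hG A hA v).2 hv)
  · intro φ ψ e he A _ hA v hv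
    -- The only premise is the identity between `φ` and `ψ` itself.
    exact (hED A hA v φ ψ).2 (hv _ rfl) e he
  · intro φ ψ A _ hA v hv
    exact (hED A hA v φ ψ).1 hv

theorem isEquivalentAlgebraicSemantics_of_mem {E : Set (Identity (Fin 1))}
    {D : Set (Formula (Fin 2))}
    (hE : E ∈ ({{.var 0 ≈ₗ (.var 0 →ₕ .var 0)}, {.var 0 ≈ₗ ⊤}} : Set (Set (Identity (Fin 1)))))
    (hD : D ∈ ({{.var 0 →ₕ .var 1, .var 1 →ₕ .var 0}, {.var 0 ↔ₕ .var 1}} :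
        Set (Set (Formula (Fin 2))))) :
    IsEquivalentAlgebraicSemantics.{u} runo1Logic.Proves RUNO1Class E D := by
  apply isEquivalentAlgebraicSemantics
  · rcases hE with rfl | rfl <;> exact Set.finite_singleton _
  · rcases hD with rfl | rfl <;> exact Set.toFinite _
  · intro A _ hA v φ
    rcases hE with rfl | rfl
    · rw [instE, Set.image_singleton]
      refine (forall_eq (a' := _)).trans ?_
      change φ.eval v = φ.eval v →ₕ φ.eval v ↔ _
      rw [hA.toIsSemiHeyting.impH_self]
    · rw [instE, Set.image_singleton]
      exact forall_eq (a' := _)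
  · intro A _ hA v φ ψ
    have sh := hA.toIsSemiHeyting
    rcases hD with rfl | rfl
    · rw [Set.forall_mem_insert]
      refine (and_congr_right' (forall_eq (a' := _))).trans ?_
      change φ.eval v →ₕ ψ.eval v = ⊤ ∧ ψ.eval v →ₕ φ.eval v = ⊤ ↔ _
      rw [sh.impH_eq_top_iff, sh.impH_eq_top_iff]
      constructor
      · rintro ⟨h₁, h₂⟩
        rw [← h₁, sh.inf_comm, h₂]
      · intro h
        rw [h, sh.inf_self]
        exact ⟨rfl, rfl⟩
    · refine (forall_eq (a' := _)).trans ?_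
      exact sh.iffH_eq_top_iff _ _

end RUNO1

end UnorthodoxLogic

open UnorthodoxLogic
theorem corollary8p3 :
    IsAlgebraizable.{u} runo1Logic.Proves ∧
    IsVariety.{u} RUNO1Class ∧
    ∀ E ∈ ({{.var 0 ≈ₗ (.var 0 →ₕ .var 0)}, {.var 0 ≈ₗ ⊤}} : Set (Set (Identity (Fin 1)))),
    ∀ D ∈ ({{.var 0 →ₕ .var 1, .var 1 →ₕ .var 0}, {.var 0 ↔ₕ .var 1}} :
        Set (Set (Formula (Fin 2)))),
      IsEquivalentAlgebraicSemantics.{u} runo1Logic.Proves RUNO1Class E D :=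
  ⟨⟨RUNO1.isLogic_proves, RUNO1Class, _, _,
      RUNO1.isEquivalentAlgebraicSemantics_of_mem (.inl rfl) (.inl rfl)⟩,
    RUNO1.isVariety, fun _ hE _ hD => RUNO1.isEquivalentAlgebraicSemantics_of_mem hE hD⟩
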